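/- Let $d \ge 1$. There is a constant $C \ge 0$, depending only on $d$, such that the following holds. Let $\Omega \subsetneq \mathbb{R}^d$ be a convex open set, let $\lambda \le 0$, let $r > 0$, and let $f : \Omega \to \mathbb{R}$ be $\lambda$-convex, i.e. $x \mapsto f(x) - \lambda |x|^2/2$ is convex on $\Omega$. Then $f$ is differentiable at Lebesgue-almost every point of $\Omega$, the function $x \mapsto \sup_{y \in B_r(x) \cap \Omega} |f(y) - (f(x) + \nabla f(x) \cdot (y - x))|$ is Lebesgue measurable on $\Omega$, and $$\int_{\Omega} \sup_{y \in B_r(x) \cap \Omega} \bigl| f(y) - \bigl(f(x) + \nabla f(x) \cdot (y - x)\bigr) \bigr| \, dx \;\le\; C\, r^2\, \mathscr{H}^{d-1}(\partial \Omega) \,\bigl( [f]_{\mathscr{C}^{0,1}(\Omega)} + |\lambda| \operatorname{diam}(\Omega) \bigr).$$ Here $|\cdot|$ is the Euclidean norm, $B_r(x)$ is the open ball of radius $r$ centered at $x$, $\mathscr{H}^{d-1}$ is the $(d-1)$-dimensional Hausdorff measure, and $[f]_{\mathscr{C}^{0,1}(\Omega)} = \sup_{x \ne y \in \Omega} |f(x)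 - f(y)|/|x - y| \in [0, \infty]$ is the Lipschitz constant of $f$ on $\Omega$. Both sides are elements of $[0, \infty]$, with the convention $0 \cdot \infty = 0$. -/

import Mathlib

open MeasureTheory Set
open scoped ENNReal NNReal

/-- `f` is `lam`-convex on `s`: the function `x ↦ f x - lam * |x|² / 2` is convex on `s`. -/
def LambdaConvexOn {E : Type*} [NormedAddCommGroup E] [InnerProductSpace ℝ E]
    (s : Set E) (lam : ℝ) (f : E → ℝ) : Prop :=
  ConvexOn ℝ s (fun x => f x - lam * (‖x‖ ^ 2 / 2))

/-- The best Lipschitz constant of `f` on `s`, that is, the supremum of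
`|f x - f y| / |x - y|` over distinct points `x, y` of `s`. It lies in `[0, ∞]`, and it equals `∞`
exactly when `f` is not Lipschitz on `s`. -/
noncomputable def lipConstOn {E : Type*} [NormedAddCommGroup E] (s : Set E) (f : E → ℝ) : ℝ≥0∞ :=
  ⨆ x ∈ s, ⨆ y ∈ s, ⨆ _ : x ≠ y, ENNReal.ofReal (|f x - f y| / ‖x - y‖)

/-- The largest error, over the points `y` of `s` with `|y - x| < r`, of the first-order Taylor
expansion of `f` at `x`, as an element of `[0, ∞]`. -/
noncomputable def supTaylorError {E : Type*} [NormedAddCommGroup E] [InnerProductSpace ℝ E]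
    [CompleteSpace E] (s : Set E) (f : E → ℝ) (r : ℝ) (x : E) : ℝ≥0∞ :=
  ⨆ y ∈ Metric.ball x r ∩ s, ENNReal.ofReal |f y - (f x + inner ℝ (gradient f x) (y - x))|

/-- The coordinate projection that forgets the `i`-th coordinate. -/
noncomputable def dropCoord {n : ℕ} (i : Fin (n + 1)) (x : EuclideanSpace ℝ (Fin (n + 1))) :
    Fin n → ℝ :=
  fun j => x (i.succAbove j)

/-- The `i`-th coordinate vector. -/
noncomputable abbrev coordVec {n : ℕ} (i : Fin (n + 1)) : EuclideanSpace ℝ (Fin (n + 1)) :=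
  EuclideanSpace.single i (1 : ℝ)

section Projection

variable {n : ℕ}

lemma dropCoord_add_smul (i : Fin (n + 1)) (x : EuclideanSpace ℝ (Fin (n + 1))) (s : ℝ) :
    dropCoord i (x + s • coordVec i) = dropCoord i x := by
  funext j
  simp [dropCoord, coordVec, Fin.succAbove_ne]

lemma lipschitzWith_dropCoord (i : Fin (n + 1)) : LipschitzWith 1 (dropCoord i) := by
  refine LipschitzWith.of_dist_le_mul fun x y => ?_
  rw [NNReal.coe_one, one_mul, dist_pi_le_iff dist_nonneg]
  intro j
  rw [dist_eq_norm, dist_eq_norm]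
  exact PiLp.norm_apply_le (x - y) (i.succAbove j)

lemma volume_image_dropCoord_le (i : Fin (n + 1)) (s : Set (EuclideanSpace ℝ (Fin (n + 1)))) :
    volume (dropCoord i '' s) ≤ Measure.hausdorffMeasure (n : ℝ) s := by
  have h := (lipschitzWith_dropCoord i).hausdorffMeasure_image_le (Nat.cast_nonneg n) s
  rw [← hausdorffMeasure_pi_real]
  simpa using h

lemma isOpen_image_dropCoord (i : Fin (n + 1)) {s : Set (EuclideanSpace ℝ (Fin (n + 1)))}
    (hs : IsOpen s) : IsOpen (dropCoord i '' s) := by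
  have key : dropCoord i '' s =
      ⋃ c : ℝ, (fun z : Fin n → ℝ => WithLp.toLp 2 (i.insertNth (α := fun _ => ℝ) c z)) ⁻¹' s := by
    ext z
    simp only [mem_image, mem_iUnion, mem_preimage]
    constructor
    · rintro ⟨x, hx, rfl⟩
      refine ⟨x i, ?_⟩
      have hxe : WithLp.toLp 2 (i.insertNth (α := fun _ => ℝ) (x i) (dropCoord i x)) = x := by
        ext j
        rcases Fin.eq_self_or_eq_succAbove i j with rfl | ⟨k, rfl⟩ <;> simp [dropCoord]
      rwa [hxe]
    · rintro ⟨c, hc⟩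
      refine ⟨_, hc, ?_⟩
      funext j
      simp [dropCoord]
  rw [key]
  refine isOpen_iUnion fun c => hs.preimage ?_
  refine (PiLp.continuous_toLp 2 _).comp ?_
  refine continuous_pi fun j => ?_
  rcases Fin.eq_self_or_eq_succAbove i j with rfl | ⟨k, rfl⟩
  · simpa using continuous_const
  · simpa using continuous_apply k

end Projection

section Lines

variable {E : Type*} [NormedAddCommGroup E] [NormedSpace ℝ E]

/-- If an open convex set contains a line, it is invariant under translations along that line. -/
lemma Convex.add_smul_mem_of_line_subset {s : Set E} (hs : Convex ℝ s) (ho : IsOpen s) {v x y : E}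
    (hx : ∀ c : ℝ, x + c • v ∈ s) (hy : y ∈ s) (c : ℝ) : y + c • v ∈ s := by
  have hcont : Continuous fun ε : ℝ => y + ε • (y - x) := by fun_prop
  have hev : ∀ᶠ ε : ℝ in nhdsWithin 0 (Ioi 0), y + ε • (y - x) ∈ s :=
    (hcont.continuousAt.eventually_mem (by simpa using ho.mem_nhds hy)).filter_mono
      nhdsWithin_le_nhds
  obtain ⟨ε, hε, hpos⟩ := (hev.and self_mem_nhdsWithin).exists
  have hpos : 0 < ε := hpos
  have h1 : (0 : ℝ) < 1 + ε := by positivity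
  have := hs hε (hx (c * (1 + ε) / ε)) (a := 1 / (1 + ε)) (b := ε / (1 + ε))
    (by positivity) (by positivity) (by field_simp)
  convert this using 1
  (match_scalars <;> field_simp); ring

/-- A line through a point of an open set that leaves the set meets the frontier. -/
lemma exists_add_smul_mem_frontier {s : Set E} {v x : E} (hx : x ∈ s) {c : ℝ}
    (hc : x + c • v ∉ s) : ∃ a : ℝ, x + a • v ∈ frontier s := by
  have hcont : Continuous fun a : ℝ => x + a • v := by fun_prop
  have hne : (frontier ((fun a : ℝ => x + a • v) ⁻¹' s)).Nonempty := by
    rw [nonempty_frontier_iff]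
    refine ⟨⟨0, by simpa using hx⟩, fun h => hc ?_⟩
    have : c ∈ (fun a : ℝ => x + a • v) ⁻¹' s := h ▸ mem_univ c
    exact this
  obtain ⟨a, ha⟩ := hne
  exact ⟨a, hcont.frontier_preimage_subset s ha⟩

end Lines

section Frontier

variable {n : ℕ} {Ω : Set (EuclideanSpace ℝ (Fin (n + 1)))}

lemma image_dropCoord_subset_frontier {i : Fin (n + 1)}
    (h : ∀ x ∈ Ω, ∃ c : ℝ, x + c • coordVec i ∉ Ω) :
    dropCoord i '' Ω ⊆ dropCoord i '' frontier Ω := by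
  rintro _ ⟨x, hx, rfl⟩
  obtain ⟨c, hc⟩ := h x hx
  obtain ⟨a, ha⟩ := exists_add_smul_mem_frontier hx hc
  exact ⟨_, ha, dropCoord_add_smul i x a⟩

/-- Invariance under all coordinate translations is impossible for a nonempty proper subset. -/
lemma eq_univ_of_forall_add_smul_mem (hne : Ω.Nonempty)
    (h : ∀ i, ∀ x ∈ Ω, ∀ c : ℝ, x + c • coordVec i ∈ Ω) : Ω = univ := by
  obtain ⟨x, hx⟩ := hne
  refine eq_univ_of_forall fun y => ?_
  have key : ∀ t : Finset (Fin (n + 1)), x + ∑ i ∈ t, (y i - x i) • coordVec i ∈ Ω := by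
    intro t
    induction t using Finset.induction_on with
    | empty => simpa using hx
    | insert a t ha ih =>
      rw [Finset.sum_insert ha, add_comm (_ • _), ← add_assoc]
      exact h a _ ih _
  convert key Finset.univ
  ext j
  simp [coordVec, Finset.sum_apply, Pi.single_apply]

lemma exists_forall_line_not_subset (ho : IsOpen Ω) (hc : Convex ℝ Ω) (hne : Ω.Nonempty)
    (hu : Ω ≠ univ) : ∃ i : Fin (n + 1), ∀ x ∈ Ω, ∃ c : ℝ, x + c • coordVec i ∉ Ω := by
  by_contra! hcon
  refine hu (eq_univ_of_forall_add_smul_mem hne fun i y hy c => ?_)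
  obtain ⟨x, -, hx⟩ := hcon i
  exact hc.add_smul_mem_of_line_subset ho hx hy c

lemma hausdorffMeasure_frontier_pos (ho : IsOpen Ω) (hc : Convex ℝ Ω) (hne : Ω.Nonempty)
    (hu : Ω ≠ univ) : 0 < Measure.hausdorffMeasure (n : ℝ) (frontier Ω) := by
  obtain ⟨i, hi⟩ := exists_forall_line_not_subset ho hc hne hu
  calc 0 < volume (dropCoord i '' Ω) :=
        (isOpen_image_dropCoord i ho).measure_pos _ (hne.image _)
    _ ≤ volume (dropCoord i '' frontier Ω) := measure_mono (image_dropCoord_subset_frontier hi)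
    _ ≤ _ := volume_image_dropCoord_le i _

/-- If the frontier has finite surface measure, then no coordinate line is contained in the
set. -/
lemma exists_add_smul_notMem (ho : IsOpen Ω) (hc : Convex ℝ Ω)
    (hu : Ω ≠ univ) (hfin : Measure.hausdorffMeasure (n : ℝ) (frontier Ω) ≠ ∞)
    (i : Fin (n + 1)) {x : EuclideanSpace ℝ (Fin (n + 1))} (hx : x ∈ Ω) :
    ∃ c : ℝ, x + c • coordVec i ∉ Ω := by
  by_contra! hline
  have hinv : ∀ y c, y + c • coordVec i ∈ Ω ↔ y ∈ Ω := fun y c =>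
    ⟨fun h => by simpa using hc.add_smul_mem_of_line_subset ho hline h (-c),
      fun h => hc.add_smul_mem_of_line_subset ho hline h c⟩
  set S : ℤ → Set (EuclideanSpace ℝ (Fin (n + 1))) := fun k =>
    frontier Ω ∩ {x | ⌊x i⌋ = k} with hS
  have hmeas : ∀ k, MeasurableSet (S k) := fun k =>
    isClosed_frontier.measurableSet.inter
      ((Int.measurable_floor.comp (by fun_prop : Measurable
        fun x : EuclideanSpace ℝ (Fin (n + 1)) => x i)) (measurableSet_singleton k))
  have hunion : frontier Ω = ⋃ k, S k := by
    ext y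
    simp [hS]
  have hdisj : Pairwise (Function.onFun Disjoint S) := by
    intro k l hkl
    refine Set.disjoint_left.2 fun y hy hy' => hkl ?_
    exact hy.2.symm.trans hy'.2
  have heq : ∀ k, Measure.hausdorffMeasure (n : ℝ) (S k) =
      Measure.hausdorffMeasure (n : ℝ) (S 0) := by
    intro k
    have hpre : (fun y : EuclideanSpace ℝ (Fin (n + 1)) => y + (k : ℝ) • coordVec i) ⁻¹' frontier Ω
        = frontier Ω := by
      have := (Homeomorph.addRight ((k : ℝ) • coordVec i)).preimage_frontier Ω
      refine this.trans (congrArg frontier ?_)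
      ext y
      exact hinv y k
    have : S 0 = (IsometryEquiv.addRight ((k : ℝ) • coordVec i)) ⁻¹' S k := by
      ext y
      have h1 : y ∈ frontier Ω ↔ y + (k : ℝ) • coordVec i ∈ frontier Ω := by
        conv_lhs => rw [← hpre]
        rfl
      simp [hS, h1, coordVec]
    rw [this, IsometryEquiv.hausdorffMeasure_preimage]
  have hpos := hausdorffMeasure_frontier_pos ho hc ⟨x, hx⟩ hu
  rw [hunion, measure_iUnion hdisj hmeas, tsum_congr heq] at hfin hpos
  by_cases h0 : Measure.hausdorffMeasure (n : ℝ) (S 0) = 0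
  · simp [h0] at hpos
  · exact hfin (ENNReal.tsum_const_eq_top_of_ne_zero h0)

end Frontier

section Slicing

/-- The integral over the line as an integral over one period of the periodization. -/
lemma lintegral_eq_lintegral_Ioc_tsum {t : ℝ} (ht : 0 < t) {φ : ℝ → ℝ≥0∞} (hφ : Measurable φ) :
    ∫⁻ s, φ s = ∫⁻ s in Ioc 0 t, ∑' k : ℤ, φ (s + k * t) := by
  have hm : ∀ k : ℤ, Measurable fun s => φ (s + k * t) :=
    fun k => hφ.comp (measurable_add_const _)
  rw [lintegral_tsum fun k => (hm k).aemeasurable,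
    ← setLIntegral_univ, ← iUnion_Ioc_add_zsmul ht 0,
    lintegral_iUnion (fun _ => measurableSet_Ioc) (pairwise_disjoint_Ioc_add_zsmul 0 t)]
  refine tsum_congr fun k => ?_
  rw [← (measurePreserving_add_right volume ((k : ℝ) * t)).setLIntegral_comp_preimage
    measurableSet_Ioc hφ]
  congr 2
  ext s
  simp only [mem_preimage, mem_Ioc, zsmul_eq_mul]
  push_cast
  constructor <;> rintro ⟨h1, h2⟩ <;> constructor <;> linarith

variable {n : ℕ}

/-- Fubini's theorem along the `i`-th coordinate, combined with periodization: a function whose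
sums along translates by `t` are at most `M` has integral at most `t * M` times the measure of the
shadow of its support. -/
lemma lintegral_le_of_tsum_le {i : Fin (n + 1)} {t : ℝ} (ht : 0 < t) {M : ℝ≥0∞}
    {Ω : Set (EuclideanSpace ℝ (Fin (n + 1)))} {F : EuclideanSpace ℝ (Fin (n + 1)) → ℝ≥0∞}
    (hF : Measurable F) (hsupp : ∀ x ∉ Ω, F x = 0)
    (hsum : ∀ x, ∑' k : ℤ, F (x + ((k : ℝ) * t) • coordVec i) ≤ M) :
    ∫⁻ x, F x ≤ ENNReal.ofReal t * M * volume (dropCoord i '' Ω) := by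
  set e := MeasurableEquiv.piFinSuccAbove (fun _ : Fin (n + 1) => ℝ) i
  have hmp := (volume_preserving_piFinSuccAbove (fun _ : Fin (n + 1) => ℝ) i).comp
    (EuclideanSpace.volume_preserving_symm_measurableEquiv_toLp (Fin (n + 1)))
  have hmp' := (hmp.symm ((MeasurableEquiv.toLp 2 (Fin (n + 1) → ℝ)).symm.trans e))
  set Ψ := ((MeasurableEquiv.toLp 2 (Fin (n + 1) → ℝ)).symm.trans e).symm
  have hΨ : ∀ s z, Ψ (s, z) = WithLp.toLp 2 (i.insertNth (α := fun _ => ℝ) s z) :=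
    fun s z => rfl
  have hΨd : ∀ s z, dropCoord i (Ψ (s, z)) = z := by
    intro s z
    funext j
    simp [hΨ, dropCoord]
  have hΨa : ∀ s z c, Ψ (s + c, z) = Ψ (s, z) + c • coordVec i := by
    intro s z c
    ext j
    rcases Fin.eq_self_or_eq_succAbove i j with rfl | ⟨k, rfl⟩ <;>
      simp [hΨ, coordVec, Fin.succAbove_ne]
  have hFΨ : Measurable fun p => F (Ψ p) := hF.comp Ψ.measurable
  rw [← hmp'.lintegral_comp hF]
  change ∫⁻ p, F (Ψ p) ∂((volume : Measure ℝ).prod (volume : Measure (Fin n → ℝ))) ≤ _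
  rw [lintegral_prod_symm' _ hFΨ]
  refine le_trans (lintegral_mono (g := (dropCoord i '' Ω).indicator
    fun _ => ENNReal.ofReal t * M) fun z => ?_) (lintegral_indicator_const_le _ _)
  by_cases hz : z ∈ dropCoord i '' Ω
  · have hm : Measurable fun s => F (Ψ (s, z)) := hFΨ.comp measurable_prodMk_right
    rw [indicator_of_mem hz, lintegral_eq_lintegral_Ioc_tsum ht hm]
    refine (lintegral_mono (g := fun _ => M) fun s => ?_).trans ?_
    · simpa only [hΨa] using hsum (Ψ (s, z))
    · simp [mul_comm]
  · rw [indicator_of_notMem hz, nonpos_iff_eq_zero]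
    refine (lintegral_congr fun s => hsupp _ fun h => hz ⟨_, h, hΨd s z⟩).trans ?_
    simp

end Slicing

section Sums

lemma sum_Icc_second_difference (u : ℤ → ℝ) {a b : ℤ} (hab : a ≤ b) :
    ∑ k ∈ Finset.Icc a b, (u (k + 1) + u (k - 1) - 2 * u k) =
      (u (b + 1) - u b) - (u a - u (a - 1)) := by
  induction b, hab using Int.leInduction with
  | base => simp; ring
  | succ b hb ih =>
    have : Finset.Icc a (b + 1) = insert (b + 1) (Finset.Icc a b) := by
      ext k
      simp only [Finset.mem_Icc, Finset.mem_insert]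
      omega
    rw [this, Finset.sum_insert (by simp), ih, add_sub_cancel_right]
    ring

/-- The positive second differences of a sequence with bounded increments, convex on an interval
of integers, have a bounded sum over that interval. -/
lemma tsum_second_difference_le {u : ℤ → ℝ} {A : Set ℤ} {B : ℝ}
    (hA : ∀ k ∈ A, ∀ l ∈ A, ∀ m, k ≤ m → m ≤ l → m ∈ A)
    (hnn : ∀ k ∈ A, 0 ≤ u (k + 1) + u (k - 1) - 2 * u k)
    (hB : ∀ k ∈ A, |u (k + 1) - u k| ≤ B ∧ |u k - u (k - 1)| ≤ B) :
    ∑' k, A.indicator (fun k => ENNReal.ofReal (u (k + 1) + u (k - 1) - 2 * u k)) k ≤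
      ENNReal.ofReal (2 * B) := by
  classical
  rw [ENNReal.tsum_eq_iSup_sum]
  refine iSup_le fun s => ?_
  set s' := s.filter (· ∈ A) with hs'
  have h1 : ∑ k ∈ s, A.indicator (fun k => ENNReal.ofReal (u (k + 1) + u (k - 1) - 2 * u k)) k =
      ∑ k ∈ s', ENNReal.ofReal (u (k + 1) + u (k - 1) - 2 * u k) := by
    rw [hs', Finset.sum_filter]
    rfl
  rw [h1]
  rcases s'.eq_empty_or_nonempty with h0 | hne
  · simp [h0]
  have hmem : ∀ k ∈ s', k ∈ A := fun k hk => (Finset.mem_filter.1 hk).2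
  set a := s'.min' hne
  set b := s'.max' hne
  have ha : a ∈ A := hmem _ (s'.min'_mem hne)
  have hb : b ∈ A := hmem _ (s'.max'_mem hne)
  have hab : a ≤ b := s'.min'_le _ (s'.max'_mem hne)
  have hsub : s' ⊆ Finset.Icc a b := fun k hk =>
    Finset.mem_Icc.2 ⟨s'.min'_le _ hk, s'.le_max' _ hk⟩
  have hAI : ∀ k ∈ Finset.Icc a b, k ∈ A := fun k hk =>
    hA a ha b hb k (Finset.mem_Icc.1 hk).1 (Finset.mem_Icc.1 hk).2
  refine (Finset.sum_le_sum_of_subset hsub).trans ?_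
  rw [← ENNReal.ofReal_sum_of_nonneg fun k hk => hnn k (hAI k hk), sum_Icc_second_difference u hab]
  refine ENNReal.ofReal_le_ofReal ?_
  have h2 := (abs_le.1 (hB b hb).1).2
  have h3 := (abs_le.1 (hB a ha).2).1
  linarith

end Sums

section Lines

variable {E : Type*} [NormedAddCommGroup E] [NormedSpace ℝ E] {s : Set E}

lemma Convex.add_smul_mem_of_mem_Icc (hs : Convex ℝ s) {x v : E} {a b c : ℝ}
    (ha : x + a • v ∈ s) (hb : x + b • v ∈ s) (hac : a ≤ c) (hcb : c ≤ b) : x + c • v ∈ s := by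
  have hpre : Convex ℝ ((fun c : ℝ => x + c • v) ⁻¹' s) := by
    have h := hs.affine_preimage (AffineMap.lineMap x (x + v) : ℝ →ᵃ[ℝ] E)
    have heq : (AffineMap.lineMap x (x + v) : ℝ → E) = fun c => x + c • v := by
      funext c
      simp [AffineMap.lineMap_apply, add_comm]
    rwa [heq] at h
  exact hpre.ordConnected.out ha hb ⟨hac, hcb⟩

/-- A walk with constant steps exits a convex set at most once. -/
lemma Convex.tsum_exit_le_one (hs : Convex ℝ s) (x v : E) :
    ∑' k : ℤ, {y | y ∈ s ∧ y + v ∉ s}.indicator (1 : E → ℝ≥0∞) (x + (k : ℝ) • v) ≤ 1 := by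
  by_cases h : ∃ k : ℤ, x + (k : ℝ) • v ∈ {y | y ∈ s ∧ y + v ∉ s}
  · obtain ⟨k, hk⟩ := h
    have hlt : ∀ k l : ℤ, x + (k : ℝ) • v ∈ {y | y ∈ s ∧ y + v ∉ s} →
        x + (l : ℝ) • v ∈ {y | y ∈ s ∧ y + v ∉ s} → ¬ k < l := by
      intro k l hk hl hkl
      have hkl' : (k : ℝ) + 1 ≤ l := by exact_mod_cast hkl
      refine hk.2 ?_
      have := hs.add_smul_mem_of_mem_Icc hk.1 hl.1 (c := k + 1) (by linarith) hkl'
      rwa [add_smul, one_smul, ← add_assoc] at this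
    rw [tsum_eq_single k]
    · exact indicator_le_self' (fun _ _ => zero_le) _
    · intro l hl
      rw [indicator_of_notMem]
      intro hl'
      rcases lt_or_gt_of_ne hl with h | h
      · exact hlt _ _ hl' hk h
      · exact hlt _ _ hk hl' h
  · push Not at h
    simp only [indicator_of_notMem (h _), tsum_zero, zero_le]

/-- The sum of the second differences of a convex Lipschitz function along a walk with constant
steps. -/
lemma ConvexOn.tsum_second_difference_le {g : E → ℝ} {K : ℝ≥0} (hg : ConvexOn ℝ s g)
    (hK : LipschitzOnWith K g s) (x v : E) :
    ∑' k : ℤ, {y | y + v ∈ s ∧ y - v ∈ s}.indicator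
        (fun y => ENNReal.ofReal (g (y + v) + g (y - v) - 2 * g y)) (x + (k : ℝ) • v) ≤
      ENNReal.ofReal (2 * (K * ‖v‖)) := by
  have hadd : ∀ k : ℤ, x + (k : ℝ) • v + v = x + ((k + 1 : ℤ) : ℝ) • v := fun k => by
    push_cast; module
  have hsub : ∀ k : ℤ, x + (k : ℝ) • v - v = x + ((k - 1 : ℤ) : ℝ) • v := fun k => by
    push_cast; module
  set A : Set ℤ := {k | x + ((k + 1 : ℤ) : ℝ) • v ∈ s ∧ x + ((k - 1 : ℤ) : ℝ) • v ∈ s} with hAdef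
  have hmid : ∀ k ∈ A, x + (k : ℝ) • v ∈ s := fun k hk =>
    hg.1.add_smul_mem_of_mem_Icc hk.2 hk.1 (by push_cast; linarith) (by push_cast; linarith)
  have hlip : ∀ y ∈ s, ∀ z ∈ s, y - z = v → |g y - g z| ≤ K * ‖v‖ := by
    intro y hy z hz h
    have := hK.norm_sub_le hy hz
    rwa [h] at this
  refine le_trans (le_of_eq ?_) (_root_.tsum_second_difference_le (A := A)
    (u := fun k => g (x + (k : ℝ) • v)) ?_ ?_ ?_)
  · refine tsum_congr fun k => ?_
    have hiff : x + (k : ℝ) • v ∈ {y | y + v ∈ s ∧ y - v ∈ s} ↔ k ∈ A := by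
      rw [mem_ofPred_eq, hadd, hsub]
      rfl
    by_cases hk : k ∈ A
    · rw [indicator_of_mem hk, indicator_of_mem (hiff.2 hk), hadd, hsub]
    · rw [indicator_of_notMem hk, indicator_of_notMem fun h => hk (hiff.1 h)]
  · intro k hk l hl m hkm hml
    have h1 : (k : ℝ) ≤ m := by exact_mod_cast hkm
    have h2 : (m : ℝ) ≤ l := by exact_mod_cast hml
    exact ⟨hg.1.add_smul_mem_of_mem_Icc hk.1 hl.1 (by push_cast; linarith) (by push_cast; linarith),
      hg.1.add_smul_mem_of_mem_Icc hk.2 hl.2 (by push_cast; linarith) (by push_cast; linarith)⟩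
  · intro k hk
    have := hg.2 hk.1 hk.2 (by norm_num : (0 : ℝ) ≤ 1 / 2)
      (by norm_num : (0 : ℝ) ≤ 1 / 2) (by norm_num)
    have heq : (1 / 2 : ℝ) • (x + ((k + 1 : ℤ) : ℝ) • v) + (1 / 2 : ℝ) • (x + ((k - 1 : ℤ) : ℝ) • v)
        = x + (k : ℝ) • v := by push_cast; module
    rw [heq] at this
    simp only [smul_eq_mul] at this
    linarith
  · intro k hk
    exact ⟨hlip _ hk.1 _ (hmid k hk) (by push_cast; module),
      hlip _ (hmid k hk) _ hk.2 (by push_cast; module)⟩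

end Lines

section Slicing

variable {n : ℕ} {Ω : Set (EuclideanSpace ℝ (Fin (n + 1)))}

lemma measurableSet_exit (ho : IsOpen Ω) (v : EuclideanSpace ℝ (Fin (n + 1))) :
    MeasurableSet {y | y ∈ Ω ∧ y + v ∉ Ω} :=
  ho.measurableSet.inter (measurable_add_const v ho.measurableSet).compl

/-- The part of a convex set from which a step in direction `± t e_i` exits the set. -/
lemma volume_exit_le (ho : IsOpen Ω) (hc : Convex ℝ Ω) (i : Fin (n + 1)) {t : ℝ} (ht : t ≠ 0) :
    volume {y | y ∈ Ω ∧ y + t • coordVec i ∉ Ω} ≤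
      ENNReal.ofReal |t| * volume (dropCoord i '' Ω) := by
  have hm := measurableSet_exit ho (t • coordVec i)
  rw [← lintegral_indicator_one hm]
  refine (lintegral_le_of_tsum_le (Ω := Ω) (i := i) (M := 1) (abs_pos.2 ht)
    (measurable_one.indicator hm) (fun x hx => indicator_of_notMem (fun h => hx h.1) _)
    fun x => ?_).trans (by rw [mul_one])
  have key := hc.tsum_exit_le_one x (t • coordVec i)
  rcases abs_cases t with ⟨h, -⟩ | ⟨h, -⟩
  · simpa only [h, smul_smul] using key
  · rw [← (Equiv.neg ℤ).tsum_eq] at key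
    simpa only [h, smul_smul, Equiv.neg_apply, Int.cast_neg, neg_mul, mul_neg] using key

/-- The volume of a bounded convex set is controlled by its diameter and its shadow. -/
lemma volume_le_diam_mul (ho : IsOpen Ω) (hc : Convex ℝ Ω) {D : ℝ} (hD : 0 < D)
    (hΩ : ∀ x ∈ Ω, ∀ y ∈ Ω, ‖x - y‖ ≤ D) (i : Fin (n + 1)) :
    volume Ω ≤ ENNReal.ofReal (2 * D) * volume (dropCoord i '' Ω) := by
  have h := volume_exit_le ho hc i (t := 2 * D) (by positivity)
  rw [abs_of_pos (by positivity)] at h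
  have hsub : Ω ⊆ {y | y ∈ Ω ∧ y + (2 * D) • coordVec i ∉ Ω} := by
    refine fun y hy => ⟨hy, fun hy' => ?_⟩
    have := hΩ _ hy' _ hy
    rw [add_sub_cancel_left, norm_smul, PiLp.norm_single, norm_one, mul_one,
      Real.norm_of_nonneg (by positivity)] at this
    linarith
  exact (measure_mono hsub).trans h

lemma lintegral_second_difference_le {g : EuclideanSpace ℝ (Fin (n + 1)) → ℝ} {K : ℝ≥0}
    (ho : IsOpen Ω) (hg : ConvexOn ℝ Ω g) (hK : LipschitzOnWith K g Ω) (i : Fin (n + 1)) {t : ℝ}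
    (ht : 0 < t) :
    Measurable ({y | y + t • coordVec i ∈ Ω ∧ y - t • coordVec i ∈ Ω}.indicator (fun y =>
        ENNReal.ofReal (g (y + t • coordVec i) + g (y - t • coordVec i) - 2 * g y))) ∧
    ∫⁻ x, {y | y + t • coordVec i ∈ Ω ∧ y - t • coordVec i ∈ Ω}.indicator (fun y =>
        ENNReal.ofReal (g (y + t • coordVec i) + g (y - t • coordVec i) - 2 * g y)) x ≤
      ENNReal.ofReal (2 * K * t ^ 2) * volume (dropCoord i '' Ω) := by
  set v := t • coordVec i with hv
  set P := {y | y + v ∈ Ω ∧ y - v ∈ Ω} with hP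
  have hPm : ∀ y ∈ P, y ∈ Ω := by
    intro y hy
    have := hg.1.add_smul_mem_of_mem_Icc (x := y) (v := v) (a := -1) (b := 1) (c := 0)
      (by simpa [← sub_eq_add_neg] using hy.2) (by simpa using hy.1) (by norm_num) (by norm_num)
    simpa using this
  have hnorm : ‖v‖ = t := by
    simp [hv, norm_smul, abs_of_pos ht]
  have hmeas : Measurable (P.indicator (fun y =>
        ENNReal.ofReal (g (y + v) + g (y - v) - 2 * g y))) := by
    have hG : Measurable (Ω.indicator g) := by
      classical
      rw [← piecewise_eq_indicator]
      exact hK.continuousOn.measurable_piecewise continuousOn_const ho.measurableSet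
    have heq : P.indicator (fun y => ENNReal.ofReal (g (y + v) + g (y - v) - 2 * g y)) =
        P.indicator (fun y => ENNReal.ofReal
          (Ω.indicator g (y + v) + Ω.indicator g (y - v) - 2 * Ω.indicator g y)) := by
      refine indicator_congr fun y hy => ?_
      rw [indicator_of_mem hy.1, indicator_of_mem hy.2, indicator_of_mem (hPm y hy)]
    rw [heq]
    refine Measurable.indicator ?_ ?_
    · exact (((hG.comp (measurable_add_const v)).add (hG.comp (measurable_sub_const v))).sub
        (hG.const_mul 2)).ennreal_ofReal
    · exact (measurable_add_const v ho.measurableSet).inter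
        (measurable_sub_const v ho.measurableSet)
  refine ⟨hmeas, (lintegral_le_of_tsum_le (Ω := Ω) (i := i) (M := ENNReal.ofReal (2 * (K * t))) ht
    hmeas (fun x hx => indicator_of_notMem (fun h => hx (hPm x h)) _) fun x => ?_).trans ?_⟩
  · have key := hg.tsum_second_difference_le hK x v
    rw [hnorm] at key
    simpa only [hv, smul_smul] using key
  · rw [← ENNReal.ofReal_mul ht.le]
    refine le_of_eq ?_
    congr 2
    ring

end Slicing

section Pointwise

variable {E : Type*} [NormedAddCommGroup E] [InnerProductSpace ℝ E] [CompleteSpace E]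
  {s : Set E} {g : E → ℝ} {K : ℝ≥0} {r : ℝ} {x y : E}

/-- The graph of a convex function lies above its tangent hyperplanes. -/
lemma ConvexOn.inner_gradient_le (hg : ConvexOn ℝ s g) (hd : DifferentiableAt ℝ g x)
    (hx : x ∈ s) (hy : y ∈ s) : inner ℝ (gradient g x) (y - x) ≤ g y - g x := by
  have h1 : HasDerivAt (fun c : ℝ => g (x + c • (y - x))) (inner ℝ (gradient g x) (y - x)) 0 := by
    have hf : HasFDerivAt g (InnerProductSpace.toDual ℝ E (gradient g x)) (x + (0 : ℝ) • (y - x)) := by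
      simpa using hd.hasGradientAt.hasFDerivAt
    have hl : HasDerivAt (fun c : ℝ => x + c • (y - x)) (y - x) 0 := by
      simpa using ((hasDerivAt_id (0 : ℝ)).smul_const (y - x)).const_add x
    exact hf.comp_hasDerivAt (0 : ℝ) hl
  refine le_of_tendsto h1.tendsto_slope_zero_right ?_
  filter_upwards [Ioo_mem_nhdsGT (zero_lt_one' ℝ)] with c hc
  have h2 := hg.2 hx hy (sub_nonneg.2 hc.2.le) hc.1.le (by ring)
  have h3 : (1 - c) • x + c • y = x + c • (y - x) := by module
  rw [h3] at h2
  simp only [smul_eq_mul, zero_add, zero_smul, add_zero] at h2 ⊢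
  rw [inv_mul_le_iff₀ hc.1]
  linarith

lemma LipschitzOnWith.norm_gradient_le (hK : LipschitzOnWith K g s) (hs : s ∈ nhds x) :
    ‖gradient g x‖ ≤ K := by
  rw [gradient, LinearIsometryEquiv.norm_map]
  exact norm_fderiv_le_of_lipschitzOn ℝ hs hK

lemma LipschitzOnWith.supTaylorError_le (hK : LipschitzOnWith K g s) (ho : IsOpen s) (hx : x ∈ s) :
    supTaylorError s g r x ≤ ENNReal.ofReal (2 * K * r) := by
  refine iSup₂_le fun y hy => ENNReal.ofReal_le_ofReal ?_
  have h1 : ‖y - x‖ ≤ r := (mem_ball_iff_norm.1 hy.1).le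
  have h2 := hK.norm_sub_le hy.2 hx
  have h3 := (norm_inner_le_norm (𝕜 := ℝ) (gradient g x) (y - x)).trans
    (mul_le_mul_of_nonneg_right (hK.norm_gradient_le (ho.mem_nhds hx)) (norm_nonneg _))
  have h4 : (K : ℝ) * ‖y - x‖ ≤ K * r := mul_le_mul_of_nonneg_left h1 K.2
  rw [Real.norm_eq_abs] at h2 h3
  have h5 := abs_sub (g y - g x) (inner ℝ (gradient g x) (y - x))
  rw [← sub_sub]
  linarith

end Pointwise

section Coordinates

variable {n : ℕ} {Ω : Set (EuclideanSpace ℝ (Fin (n + 1)))}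
  {g : EuclideanSpace ℝ (Fin (n + 1)) → ℝ} {r : ℝ}

/-- A nonnegative convex function on a ball is controlled by its values at the vertices of a
larger cross-polytope. -/
lemma ConvexOn.le_sum_cross_polytope {D : EuclideanSpace ℝ (Fin (n + 1)) → ℝ}
    (hD : ConvexOn ℝ Ω D) (hnn : ∀ y ∈ Ω, 0 ≤ D y) {x y : EuclideanSpace ℝ (Fin (n + 1))}
    (hr : 0 < r)
    (hin : ∀ i, x + ((n + 1) * r) • coordVec i ∈ Ω ∧ x - ((n + 1) * r) • coordVec i ∈ Ω)
    (hy : ‖y - x‖ < r) :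
    D y ≤ ∑ i, (D (x + ((n + 1) * r) • coordVec i) + D (x - ((n + 1) * r) • coordVec i)) := by
  set t := (n + 1) * r with ht
  have ht0 : 0 < t := by positivity
  set c : Fin (n + 1) → ℝ := fun i => (y - x) i with hc
  have hcr : ∀ i, |c i| ≤ r := fun i => (PiLp.norm_apply_le (y - x) i).trans hy.le
  set p : Fin (n + 1) → EuclideanSpace ℝ (Fin (n + 1)) := fun i =>
    x + ((n + 1) * c i) • coordVec i with hp
  have hpeq : ∀ i, p i = ((1 + c i / r) / 2) • (x + t • coordVec i) +
      ((1 - c i / r) / 2) • (x - t • coordVec i) := by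
    intro i
    simp only [hp, ht]
    match_scalars <;> field_simp <;> ring
  have hw : ∀ i, 0 ≤ (1 + c i / r) / 2 ∧ 0 ≤ (1 - c i / r) / 2 := by
    intro i
    have h1 := abs_le.1 (hcr i)
    have h2 : c i / r ≤ 1 := (div_le_one hr).2 h1.2
    have h3 : -1 ≤ c i / r := by rw [le_div_iff₀ hr]; linarith
    constructor <;> linarith
  have hpmem : ∀ i, p i ∈ Ω := fun i => by
    rw [hpeq]
    exact hD.1 (hin i).1 (hin i).2 (hw i).1 (hw i).2 (by ring)
  have hDp : ∀ i, D (p i) ≤ D (x + t • coordVec i) + D (x - t • coordVec i) := by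
    intro i
    rw [hpeq]
    refine (hD.2 (hin i).1 (hin i).2 (hw i).1 (hw i).2 (by ring)).trans ?_
    simp only [smul_eq_mul]
    exact add_le_add
      (mul_le_of_le_one_left (hnn _ (hin i).1) (by linarith [(hw i).2]))
      (mul_le_of_le_one_left (hnn _ (hin i).2) (by linarith [(hw i).1]))
  have hN : (0 : ℝ) < n + 1 := by positivity
  have hysum : ∑ i, (1 / ((n : ℝ) + 1)) • p i = y := by
    ext j
    simp [hp, hc, coordVec, Pi.single_apply, Finset.sum_add_distrib]
    field_simp
    ring
  have h := hD.map_sum_le (t := Finset.univ) (w := fun _ => 1 / ((n : ℝ) + 1)) (p := p)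
    (fun _ _ => by positivity) (by simp; field_simp) (fun i _ => hpmem i)
  rw [hysum] at h
  refine h.trans (Finset.sum_le_sum fun i _ => ?_)
  rw [smul_eq_mul]
  refine (mul_le_of_le_one_left (hnn _ (hpmem i)) ?_).trans (hDp i)
  rw [div_le_one hN]
  linarith [Nat.cast_nonneg (α := ℝ) n]

lemma ConvexOn.supTaylorError_le (hg : ConvexOn ℝ Ω g) (hr : 0 < r)
    {x : EuclideanSpace ℝ (Fin (n + 1))} (hx : x ∈ Ω) (hd : DifferentiableAt ℝ g x)
    (hin : ∀ i, x + ((n + 1) * r) • coordVec i ∈ Ω ∧ x - ((n + 1) * r) • coordVec i ∈ Ω) :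
    supTaylorError Ω g r x ≤ ∑ i, ENNReal.ofReal (g (x + ((n + 1) * r) • coordVec i) +
      g (x - ((n + 1) * r) • coordVec i) - 2 * g x) := by
  set D : EuclideanSpace ℝ (Fin (n + 1)) → ℝ := fun y =>
    g y - (g x + inner ℝ (gradient g x) (y - x)) with hDdef
  have hnn : ∀ y ∈ Ω, 0 ≤ D y := fun y hy => by
    have := hg.inner_gradient_le hd hx hy
    simp only [hDdef]
    linarith
  have hD : ConvexOn ℝ Ω D := by
    refine ⟨hg.1, fun y hy z hz a b ha hb hab => ?_⟩
    have h1 := hg.2 hy hz ha hb hab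
    have h2 : a • y + b • z - x = a • (y - x) + b • (z - x) := by
      have : x = (a + b) • x := by rw [hab, one_smul]
      nth_rewrite 1 [this]
      module
    simp only [hDdef, h2, inner_add_right, inner_smul_right, smul_eq_mul] at h1 ⊢
    have h3 : g x = a * g x + b * g x := by rw [← add_mul, hab, one_mul]
    linarith
  have hsum : ∀ v, D (x + v) + D (x - v) = g (x + v) + g (x - v) - 2 * g x := by
    intro v
    have : x - v - x = -v := by abel
    simp only [hDdef, add_sub_cancel_left, this, inner_neg_right]
    ring
  refine iSup₂_le fun y hy => ?_
  change ENNReal.ofReal |D y| ≤ _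
  rw [abs_of_nonneg (hnn y hy.2), ← ENNReal.ofReal_sum_of_nonneg]
  · refine ENNReal.ofReal_le_ofReal ?_
    refine (hD.le_sum_cross_polytope hnn hr hin (mem_ball_iff_norm.1 hy.1)).trans_eq ?_
    exact Finset.sum_congr rfl fun i _ => hsum _
  · intro i _
    rw [← hsum]
    exact add_nonneg (hnn _ (hin i).1) (hnn _ (hin i).2)

end Coordinates

section Regularity

variable {E : Type*} [NormedAddCommGroup E] [InnerProductSpace ℝ E] [FiniteDimensional ℝ E]
  [MeasurableSpace E] [BorelSpace E] {s : Set E} {f : E → ℝ}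

/-- A convex function on an open set is differentiable almost everywhere. -/
lemma ConvexOn.ae_restrict_differentiableAt (hf : ConvexOn ℝ s f) (hs : IsOpen s) (μ : Measure E)
    [μ.IsAddHaarMeasure] : ∀ᵐ x ∂μ.restrict s, DifferentiableAt ℝ f x := by
  rw [ae_restrict_iff' hs.measurableSet, ae_iff]
  refine measure_null_of_locally_null _ fun x hx => ?_
  have hxs : x ∈ s := by
    by_contra h
    exact hx fun h' => absurd h' h
  obtain ⟨K, t, ht, hK⟩ := hf.locallyLipschitzOn hs hxs
  rw [hs.nhdsWithin_eq hxs] at ht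
  obtain ⟨u, hut, huo, hxu⟩ := mem_nhds_iff.1 ht
  refine ⟨{y | ¬(y ∈ s → DifferentiableAt ℝ f y)} ∩ u,
    inter_mem_nhdsWithin _ (huo.mem_nhds hxu), ?_⟩
  have h := (hK.mono hut).ae_differentiableWithinAt (μ := μ) huo.measurableSet
  rw [ae_restrict_iff' huo.measurableSet, ae_iff] at h
  have hsub : {y | ¬(y ∈ s → DifferentiableAt ℝ f y)} ∩ u ⊆
      {y | ¬(y ∈ u → DifferentiableWithinAt ℝ f u y)} := fun y hy hy' =>
    hy.1 fun _ => (hy' hy.2).differentiableAt (huo.mem_nhds hy.2)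
  exact measure_mono_null hsub h

lemma measurable_gradient (f : E → ℝ) : Measurable (gradient f) :=
  (InnerProductSpace.toDual ℝ E).symm.continuous.measurable.comp (measurable_fderiv ℝ f)

lemma aemeasurable_supTaylorError (hs : IsOpen s) (hf : ContinuousOn f s) (r : ℝ) (μ : Measure E) :
    AEMeasurable (supTaylorError s f r) (μ.restrict s) := by
  obtain ⟨Q, hQc, hQd⟩ := TopologicalSpace.exists_countable_dense E
  set h : E → E → ℝ≥0∞ := fun x y =>
    ENNReal.ofReal |f y - (f x + inner ℝ (gradient f x) (y - x))| with hh
  have hfm : AEMeasurable f (μ.restrict s) := hf.aemeasurable hs.measurableSet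
  have hmeas : AEMeasurable
      (fun x => ⨆ y ∈ Q ∩ s, (Metric.ball y r).indicator (fun x => h x y) x) (μ.restrict s) := by
    refine AEMeasurable.biSup _ (hQc.mono inter_subset_left) fun y _ => ?_
    refine AEMeasurable.indicator ?_ measurableSet_ball
    have h1 : Measurable fun x => inner ℝ (gradient f x) (y - x) :=
      (measurable_gradient f).inner (measurable_const.sub measurable_id)
    have h2 : AEMeasurable (fun x => f y - (f x + inner ℝ (gradient f x) (y - x)))
      (μ.restrict s) := (hfm.add h1.aemeasurable).const_sub _
    exact (continuous_abs.measurable.comp_aemeasurable h2).ennreal_ofReal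
  refine hmeas.congr (Filter.Eventually.of_forall fun x => le_antisymm ?_ ?_)
  · refine iSup₂_le fun y hy => ?_
    by_cases hyx : x ∈ Metric.ball y r
    · rw [indicator_of_mem hyx]
      exact le_iSup₂_of_le (f := fun y _ => h x y) y ⟨Metric.mem_ball_comm.1 hyx, hy.2⟩ le_rfl
    · rw [indicator_of_notMem hyx]
      exact zero_le
  · refine iSup₂_le fun y hy => ?_
    have hWo : IsOpen (Metric.ball x r ∩ s) := Metric.isOpen_ball.inter hs
    have hcont : ContinuousWithinAt (h x) ((Metric.ball x r ∩ s) ∩ Q) y := by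
      have hfy : ContinuousAt f y := hf.continuousAt (hs.mem_nhds hy.2)
      refine ContinuousAt.continuousWithinAt ?_
      refine ENNReal.continuous_ofReal.continuousAt.comp (ContinuousAt.abs ?_)
      fun_prop
    have hcl := hcont.mem_closure_image (hQd.open_subset_closure_inter hWo hy)
    refine closure_minimal (t := Iic _) ?_ isClosed_Iic hcl
    rintro _ ⟨z, hz, rfl⟩
    have hzs : z ∈ Q ∩ s := ⟨hz.2, hz.1.2⟩
    refine le_iSup₂_of_le (f := fun y _ => (Metric.ball y r).indicator (fun x => h x y) x) z hzs ?_
    rw [indicator_of_mem (Metric.mem_ball_comm.1 hz.1.1)]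

end Regularity

section Integrals

variable {n : ℕ} {Ω : Set (EuclideanSpace ℝ (Fin (n + 1)))}
  {g : EuclideanSpace ℝ (Fin (n + 1)) → ℝ} {K : ℝ≥0} {r : ℝ}

/-- The integrated Taylor error of a convex Lipschitz function, in terms of the areas of the
coordinate shadows of its domain. -/
lemma ConvexOn.lintegral_supTaylorError_le (ho : IsOpen Ω) (hg : ConvexOn ℝ Ω g)
    (hK : LipschitzOnWith K g Ω) (hr : 0 < r) {H : ℝ≥0∞}
    (hH : ∀ i, volume (dropCoord i '' Ω) ≤ H) :
    ∫⁻ x in Ω, supTaylorError Ω g r x ≤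
      ENNReal.ofReal ((n + 1) * (2 * (n + 1) ^ 2 + 4 * (n + 1)) * K * r ^ 2) * H := by
  set t := (n + 1) * r with ht
  have ht0 : 0 < t := by positivity
  set F : Fin (n + 1) → EuclideanSpace ℝ (Fin (n + 1)) → ℝ≥0∞ := fun i =>
    {y | y + t • coordVec i ∈ Ω ∧ y - t • coordVec i ∈ Ω}.indicator (fun y =>
        ENNReal.ofReal (g (y + t • coordVec i) + g (y - t • coordVec i) - 2 * g y)) with hF
  set P : Fin (n + 1) → Set (EuclideanSpace ℝ (Fin (n + 1))) := fun i =>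
    {y | y ∈ Ω ∧ y + t • coordVec i ∉ Ω} with hP
  set Q : Fin (n + 1) → Set (EuclideanSpace ℝ (Fin (n + 1))) := fun i =>
    {y | y ∈ Ω ∧ y + (-t) • coordVec i ∉ Ω} with hQ
  have hFm : ∀ i, Measurable (F i) := fun i => (lintegral_second_difference_le ho hg hK i ht0).1
  have hPm : ∀ i, MeasurableSet (P i) := fun i => measurableSet_exit ho _
  have hQm : ∀ i, MeasurableSet (Q i) := fun i => measurableSet_exit ho _
  have hPi : ∀ i, Measurable ((P i).indicator (1 : EuclideanSpace ℝ (Fin (n + 1)) → ℝ≥0∞)) := fun i =>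
    measurable_one.indicator (hPm i)
  have hQi : ∀ i, Measurable ((Q i).indicator (1 : EuclideanSpace ℝ (Fin (n + 1)) → ℝ≥0∞)) := fun i =>
    measurable_one.indicator (hQm i)
  set c := ENNReal.ofReal (2 * K * r) with hc
  have hpt : ∀ᵐ x ∂volume.restrict Ω, supTaylorError Ω g r x ≤
      ∑ i, (F i x + c * ((P i).indicator 1 x + (Q i).indicator 1 x)) := by
    filter_upwards [hg.ae_restrict_differentiableAt ho volume, ae_restrict_mem ho.measurableSet]
      with x hd hx
    by_cases hin : ∀ i, x + t • coordVec i ∈ Ω ∧ x - t • coordVec i ∈ Ω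
    · refine (hg.supTaylorError_le hr hx hd hin).trans (Finset.sum_le_sum fun i _ => ?_)
      have hFi : F i x =
          ENNReal.ofReal (g (x + t • coordVec i) + g (x - t • coordVec i) - 2 * g x) :=
        indicator_of_mem (show x ∈ {y | y + t • coordVec i ∈ Ω ∧ y - t • coordVec i ∈ Ω} from hin i) _
      rw [hFi]
      exact le_self_add
    · obtain ⟨i, hi⟩ := not_forall.1 hin
      refine (hK.supTaylorError_le ho hx).trans ?_
      refine le_trans ?_ (Finset.single_le_sum (f := fun i =>
        F i x + c * ((P i).indicator 1 x + (Q i).indicator 1 x)) (fun _ _ => zero_le)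
        (Finset.mem_univ i))
      refine le_trans ?_ le_add_self
      refine le_mul_of_one_le_right' ?_
      rcases not_and_or.1 hi with h | h
      · have : x ∈ P i := ⟨hx, h⟩
        rw [indicator_of_mem this]
        exact le_self_add
      · have : x ∈ Q i := ⟨hx, by rwa [neg_smul, ← sub_eq_add_neg]⟩
        rw [indicator_of_mem this]
        exact le_add_self
  have hterm : ∀ i, ∫⁻ x, (F i x + c * ((P i).indicator 1 x + (Q i).indicator 1 x)) ≤
      ENNReal.ofReal ((2 * (n + 1) ^ 2 + 4 * (n + 1)) * K * r ^ 2) * H := by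
    intro i
    have hPQ : Measurable fun x => (P i).indicator (1 : EuclideanSpace ℝ (Fin (n + 1)) → ℝ≥0∞) x +
        (Q i).indicator 1 x := (hPi i).add (hQi i)
    rw [lintegral_add_left (hFm i), lintegral_const_mul _ hPQ,
      lintegral_add_left (hPi i), lintegral_indicator_one (hPm i), lintegral_indicator_one (hQm i)]
    have h1 := (lintegral_second_difference_le ho hg hK i ht0).2.trans (mul_le_mul_right (hH i) _)
    have h2 := (volume_exit_le ho hg.1 i ht0.ne').trans (mul_le_mul_right (hH i) _)
    have h3 := (volume_exit_le ho hg.1 i (neg_ne_zero.2 ht0.ne')).trans (mul_le_mul_right (hH i) _)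
    rw [abs_neg, abs_of_pos ht0] at h3
    rw [abs_of_pos ht0] at h2
    refine (add_le_add h1 (mul_le_mul_right (add_le_add h2 h3) c)).trans (le_of_eq ?_)
    rw [← add_mul, ← ENNReal.ofReal_add ht0.le ht0.le, hc, ← mul_assoc,
      ← ENNReal.ofReal_mul (by positivity), ← add_mul,
      ← ENNReal.ofReal_add (by positivity) (by positivity)]
    congr 2
    rw [ht]
    ring
  calc ∫⁻ x in Ω, supTaylorError Ω g r x
      ≤ ∫⁻ x in Ω, ∑ i, (F i x + c * ((P i).indicator 1 x + (Q i).indicator 1 x)) :=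
        lintegral_mono_ae hpt
    _ ≤ ∫⁻ x, ∑ i, (F i x + c * ((P i).indicator 1 x + (Q i).indicator 1 x)) :=
        setLIntegral_le_lintegral _ _
    _ = ∑ i, ∫⁻ x, (F i x + c * ((P i).indicator 1 x + (Q i).indicator 1 x)) :=
        lintegral_finsetSum _ fun i _ => (hFm i).add (((hPi i).add (hQi i)).const_mul _)
    _ ≤ ∑ _i : Fin (n + 1), ENNReal.ofReal ((2 * (n + 1) ^ 2 + 4 * (n + 1)) * K * r ^ 2) * H :=
        Finset.sum_le_sum fun i _ => hterm i
    _ = _ := by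
      rw [Finset.sum_const, Finset.card_univ, Fintype.card_fin, nsmul_eq_mul, ← mul_assoc,
        ← ENNReal.ofReal_natCast, ← ENNReal.ofReal_mul (by positivity)]
      congr 2
      push_cast
      ring

end Integrals

section Seminorm

variable {E : Type*} [NormedAddCommGroup E] {s : Set E} {f : E → ℝ} {lam : ℝ} {x₀ : E}

lemma abs_sub_le_of_lipConstOn_ne_top (hL : lipConstOn s f ≠ ∞) {x y : E} (hx : x ∈ s)
    (hy : y ∈ s) : |f x - f y| ≤ (lipConstOn s f).toReal * ‖x - y‖ := by
  rcases eq_or_ne x y with rfl | hxy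
  · simp
  have h : ENNReal.ofReal (|f x - f y| / ‖x - y‖) ≤ lipConstOn s f :=
    le_iSup₂_of_le x hx (le_iSup₂_of_le y hy (le_iSup_of_le hxy le_rfl))
  have h' := (ENNReal.ofReal_le_iff_le_toReal hL).1 h
  rwa [div_le_iff₀ (norm_pos_iff.2 (sub_ne_zero.2 hxy))] at h'

lemma mul_norm_sub_le_of_mul_ediam_ne_top (hD : ENNReal.ofReal |lam| * Metric.ediam s ≠ ∞)
    {x y : E} (hx : x ∈ s) (hy : y ∈ s) :
    |lam| * ‖x - y‖ ≤ (ENNReal.ofReal |lam| * Metric.ediam s).toReal := by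
  rw [← ENNReal.ofReal_le_iff_le_toReal hD, ENNReal.ofReal_mul (abs_nonneg _), ← dist_eq_norm,
    ← edist_dist]
  exact mul_le_mul_right (Metric.edist_le_ediam_of_mem hx hy) _

lemma lipschitzOnWith_sub (hL : lipConstOn s f ≠ ∞)
    (hD : ENNReal.ofReal |lam| * Metric.ediam s ≠ ∞) (hx₀ : x₀ ∈ s) :
    LipschitzOnWith (lipConstOn s f + ENNReal.ofReal |lam| * Metric.ediam s).toNNReal
      (fun x => f x - lam * (‖x - x₀‖ ^ 2 / 2)) s := by
  refine LipschitzOnWith.of_dist_le_mul fun x hx y hy => ?_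
  rw [ENNReal.coe_toNNReal_eq_toReal, ENNReal.toReal_add hL hD, Real.dist_eq, dist_eq_norm]
  have h1 := abs_sub_le_of_lipConstOn_ne_top hL hx hy
  have h2 := mul_norm_sub_le_of_mul_ediam_ne_top hD hx hx₀
  have h3 := mul_norm_sub_le_of_mul_ediam_ne_top hD hy hx₀
  have h4 : |‖x - x₀‖ - ‖y - x₀‖| ≤ ‖x - y‖ := by
    simpa using abs_norm_sub_norm_le (x - x₀) (y - x₀)
  set D := (ENNReal.ofReal |lam| * Metric.ediam s).toReal
  have h5 : |lam * (‖x - x₀‖ ^ 2 / 2) - lam * (‖y - x₀‖ ^ 2 / 2)| ≤ D * ‖x - y‖ := by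
    have : lam * (‖x - x₀‖ ^ 2 / 2) - lam * (‖y - x₀‖ ^ 2 / 2) =
        lam * ((‖x - x₀‖ + ‖y - x₀‖) / 2) * (‖x - x₀‖ - ‖y - x₀‖) := by ring
    rw [this, abs_mul, abs_mul, abs_of_nonneg (by positivity : 0 ≤ (‖x - x₀‖ + ‖y - x₀‖) / 2)]
    exact mul_le_mul (by linarith) h4 (abs_nonneg _) (ENNReal.toReal_nonneg)
  have h6 := abs_sub (f x - f y) (lam * (‖x - x₀‖ ^ 2 / 2) - lam * (‖y - x₀‖ ^ 2 / 2))
  have h7 : f x - lam * (‖x - x₀‖ ^ 2 / 2) - (f y - lam * (‖y - x₀‖ ^ 2 / 2)) =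
    f x - f y - (lam * (‖x - x₀‖ ^ 2 / 2) - lam * (‖y - x₀‖ ^ 2 / 2)) := by ring
  rw [h7, add_mul]
  linarith

end Seminorm

section LambdaConvex

variable {E : Type*} [NormedAddCommGroup E] [InnerProductSpace ℝ E] {s : Set E} {f : E → ℝ}
  {lam r : ℝ} {x₀ : E}

lemma LambdaConvexOn.convexOn_sub (hf : LambdaConvexOn s lam f) (x₀ : E) :
    ConvexOn ℝ s fun x => f x - lam * (‖x - x₀‖ ^ 2 / 2) := by
  refine ⟨hf.1, fun y hy z hz a b ha hb hab => ?_⟩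
  have h1 := hf.2 hy hz ha hb hab
  simp only [norm_sub_sq_real, inner_add_left, real_inner_smul_left, smul_eq_mul] at h1 ⊢
  have h3 : ‖x₀‖ ^ 2 = a * ‖x₀‖ ^ 2 + b * ‖x₀‖ ^ 2 := by rw [← add_mul, hab, one_mul]
  linear_combination h1 - lam / 2 * h3

variable [CompleteSpace E]

lemma hasGradientAt_mul_norm_sub_sq (lam : ℝ) (x₀ x : E) :
    HasGradientAt (fun y => lam * (‖y - x₀‖ ^ 2 / 2)) (lam • (x - x₀)) x := by
  have hfun : (fun y => lam * (‖y - x₀‖ ^ 2 / 2)) = fun y => lam / 2 * ‖id y - x₀‖ ^ 2 := by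
    funext y
    simp only [id]
    ring
  rw [hasGradientAt_iff_hasFDerivAt, hfun]
  refine ((((hasFDerivAt_id x).sub_const x₀).norm_sq).const_mul (lam / 2)).congr_fderiv ?_
  ext v
  simp
  ring

lemma supTaylorError_le_add {x : E}
    (hd : DifferentiableAt ℝ (fun y => f y - lam * (‖y - x₀‖ ^ 2 / 2)) x) :
    DifferentiableAt ℝ f x ∧ supTaylorError s f r x ≤
      supTaylorError s (fun y => f y - lam * (‖y - x₀‖ ^ 2 / 2)) r x +
        ENNReal.ofReal (|lam| * (r ^ 2 / 2)) := by
  set g := fun y => f y - lam * (‖y - x₀‖ ^ 2 / 2) with hg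
  have hq := hasGradientAt_mul_norm_sub_sq lam x₀ x
  have hf : HasGradientAt f (gradient g x + lam • (x - x₀)) x := by
    have hfun : f = g + fun y => lam * (‖y - x₀‖ ^ 2 / 2) := by
      funext y
      simp [hg]
    rw [hasGradientAt_iff_hasFDerivAt, map_add]
    nth_rewrite 1 [hfun]
    exact hd.hasGradientAt.hasFDerivAt.add hq.hasFDerivAt
  refine ⟨hf.differentiableAt, iSup₂_le fun y hy => ?_⟩
  have hyr : ‖y - x‖ < r := mem_ball_iff_norm.1 hy.1
  have heq : f y - (f x + inner ℝ (gradient f x) (y - x)) =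
      (g y - (g x + inner ℝ (gradient g x) (y - x))) + lam * (‖y - x‖ ^ 2 / 2) := by
    have h1 : ‖y - x₀‖ ^ 2 = ‖x - x₀‖ ^ 2 + 2 * inner ℝ (x - x₀) (y - x) + ‖y - x‖ ^ 2 := by
      rw [← norm_add_sq_real]
      congr 2
      abel
    rw [hf.gradient, inner_add_left, real_inner_smul_left]
    simp only [hg, h1]
    ring
  rw [heq]
  refine (ENNReal.ofReal_le_ofReal (abs_add_le _ _)).trans ?_
  rw [ENNReal.ofReal_add (abs_nonneg _) (abs_nonneg _)]
  refine add_le_add (le_iSup₂_of_le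
    (f := fun y _ => ENNReal.ofReal |g y - (g x + inner ℝ (gradient g x) (y - x))|) y hy le_rfl) ?_
  refine ENNReal.ofReal_le_ofReal ?_
  rw [abs_mul, abs_of_nonneg (by positivity : 0 ≤ ‖y - x‖ ^ 2 / 2)]
  gcongr

end LambdaConvex

theorem mainTheorem6 (d : ℕ) (hd : 1 ≤ d) :
    ∃ C : ℝ≥0, ∀ (Ω : Set (EuclideanSpace ℝ (Fin d))) (f : EuclideanSpace ℝ (Fin d) → ℝ)
      (lam r : ℝ),
      IsOpen Ω → Convex ℝ Ω → Ω ≠ univ → lam ≤ 0 → LambdaConvexOn Ω lam f → 0 < r →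
        (∀ᵐ x ∂(volume.restrict Ω), DifferentiableAt ℝ f x) ∧
        AEMeasurable (supTaylorError Ω f r) (volume.restrict Ω) ∧
        ∫⁻ x in Ω, supTaylorError Ω f r x ≤
          C * ENNReal.ofReal (r ^ 2) * Measure.hausdorffMeasure ((d : ℝ) - 1) (frontier Ω) *
            (lipConstOn Ω f + ENNReal.ofReal |lam| * Metric.ediam Ω) := by
  obtain ⟨n, rfl⟩ : ∃ n, d = n + 1 := ⟨d - 1, by omega⟩
  refine ⟨(n + 1) * (2 * (n + 1) ^ 2 + 4 * (n + 1)) + 1, ?_⟩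
  intro Ω f lam r ho hc hu _ hf hr
  have hdim : ((n + 1 : ℕ) : ℝ) - 1 = n := by push_cast; ring
  rw [hdim]
  set H := Measure.hausdorffMeasure (n : ℝ) (frontier Ω) with hH
  have hae := fun x₀ => (hf.convexOn_sub x₀).ae_restrict_differentiableAt ho volume
  have hcont : ContinuousOn f Ω := by
    have h1 : ContinuousOn (fun x => f x - lam * (‖x‖ ^ 2 / 2) + lam * (‖x‖ ^ 2 / 2)) Ω :=
      (ConvexOn.continuousOn ho hf).add (by fun_prop)
    simpa using h1
  refine ⟨(hae 0).mono fun x hx => (supTaylorError_le_add (s := Ω) (r := r) hx).1,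
    aemeasurable_supTaylorError ho hcont r volume, ?_⟩
  rcases Ω.eq_empty_or_nonempty with rfl | hne
  · simp
  obtain ⟨x₀, hx₀⟩ := hne
  set B := lipConstOn Ω f + ENNReal.ofReal |lam| * Metric.ediam Ω with hB
  have hHpos : H ≠ 0 := (hausdorffMeasure_frontier_pos ho hc ⟨x₀, hx₀⟩ hu).ne'
  have hC : (((n + 1) * (2 * (n + 1) ^ 2 + 4 * (n + 1)) + 1 : ℝ≥0) : ℝ≥0∞) *
      ENNReal.ofReal (r ^ 2) ≠ 0 :=
    mul_ne_zero (by simp) (by simpa using hr.ne')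
  rcases eq_or_ne B ∞ with hBtop | hBtop
  · rw [hBtop, ENNReal.mul_top (mul_ne_zero hC hHpos)]
    exact le_top
  obtain ⟨hL, hD⟩ := ENNReal.add_ne_top.1 hBtop
  have hlip := lipschitzOnWith_sub hL hD hx₀
  rw [← hB] at hlip
  have hshadow : H ≠ ∞ → ∀ i, volume (dropCoord i '' Ω) ≤ H := fun hfin i =>
    (measure_mono (image_dropCoord_subset_frontier fun x hx =>
      exists_add_smul_notMem ho hc hu hfin i hx)).trans (volume_image_dropCoord_le i _)
  have hadd := (lintegral_mono_ae ((hae x₀).mono fun x hx =>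
    (supTaylorError_le_add (s := Ω) (r := r) hx).2)).trans_eq
    (lintegral_add_right _ measurable_const)
  have hquad : ∫⁻ x in Ω, ENNReal.ofReal (|lam| * (r ^ 2 / 2)) ≤
      ENNReal.ofReal (r ^ 2) * H * B := by
    rcases eq_or_ne lam 0 with rfl | hlam
    · simp
    have hlam' : ENNReal.ofReal |lam| ≠ 0 := by simpa using hlam
    have hdiam : Metric.ediam Ω ≠ ∞ := fun h => hD (by rw [h, ENNReal.mul_top hlam'])
    have hdiam0 : Metric.ediam Ω ≠ 0 := fun h => by
      have := (Metric.ediam_eq_zero_iff.1 h).eq_singleton_of_mem hx₀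
      exact not_isOpen_singleton x₀ (this ▸ ho)
    have hB0 : B ≠ 0 := fun h => mul_ne_zero hlam' hdiam0 (add_eq_zero.1 h).2
    rcases eq_or_ne H ∞ with hHtop | hHtop
    · rw [hHtop, ENNReal.mul_top (by simpa using hr.ne'), ENNReal.top_mul hB0]
      exact le_top
    have hvol := (volume_le_diam_mul ho hc (ENNReal.toReal_pos hdiam0 hdiam) (fun x hx y hy => by
      rw [← dist_eq_norm, ← ENNReal.ofReal_le_iff_le_toReal hdiam, ← edist_dist]
      exact Metric.edist_le_ediam_of_mem hx hy) 0).trans (mul_le_mul_right (hshadow hHtop 0) _)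
    rw [setLIntegral_const]
    refine (mul_le_mul_right hvol _).trans ?_
    calc _ = ENNReal.ofReal (r ^ 2) * H * (ENNReal.ofReal |lam| * Metric.ediam Ω) := by
          rw [← mul_assoc, ← ENNReal.ofReal_mul (by positivity),
            show |lam| * (r ^ 2 / 2) * (2 * (Metric.ediam Ω).toReal) =
              r ^ 2 * (|lam| * (Metric.ediam Ω).toReal) by ring,
            ENNReal.ofReal_mul (by positivity), ENNReal.ofReal_mul (by positivity),
            ENNReal.ofReal_toReal hdiam]
          ring
      _ ≤ _ := mul_le_mul_right le_add_self _
  have hconv : ∫⁻ x in Ω, supTaylorError Ω (fun y => f y - lam * (‖y - x₀‖ ^ 2 / 2)) r x ≤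
      ENNReal.ofReal ((n + 1) * (2 * (n + 1) ^ 2 + 4 * (n + 1)) * B.toNNReal * r ^ 2) * H := by
    rcases eq_or_ne H ∞ with hHtop | hHtop
    · rcases eq_or_ne B 0 with hB0 | hB0
      · rw [hB0] at hlip
        refine (setLIntegral_mono' ho.measurableSet fun x hx =>
          hlip.supTaylorError_le ho hx).trans ?_
        simp
      · have hBpos : (0 : ℝ) < B.toNNReal :=
          NNReal.coe_pos.2 (ENNReal.toNNReal_pos hB0 hBtop)
        rw [hHtop, ENNReal.mul_top (ENNReal.ofReal_pos.2 (by positivity)).ne']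
        exact le_top
    · exact (hf.convexOn_sub x₀).lintegral_supTaylorError_le ho hlip hr (hshadow hHtop)
  refine (hadd.trans (add_le_add hconv hquad)).trans_eq ?_
  rw [ENNReal.ofReal_mul (by positivity), ENNReal.ofReal_mul (by positivity),
    ENNReal.ofReal_coe_nnreal, ENNReal.coe_toNNReal hBtop, ENNReal.coe_add, ENNReal.coe_one,
    ← ENNReal.ofReal_coe_nnreal]
  push_cast
  ring
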